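/- The series $\sum_{n\ge 2}(n\log n)^{-s}$ converges absolutely for every complex $s$ with $\operatorname{Re} s>1$. There is a (necessarily unique) real constant $C_{1,1}$ such that $$\sum_{k=2}^{n-1}\frac{1}{k\log k}=\log\log n+C_{1,1}+o(1)\qquad(n\to\infty),$$ and with this constant $$\sum_{n=2}^{\infty}\frac{1}{(n\log n)^{s}}=-\log(s-1)+C_{1,1}-\gamma+O\big((s-1)\log^2(s-1)\big)$$ as $s\to1$ in the half-plane $\operatorname{Re} s>1$, where $\log$ is the principal logarithm and $\gamma$ is the Euler–Mascheroni constant. -/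

import Mathlib

open Filter Topology Asymptotics

/-- The Dirichlet-type series `∑_{n ≥ 2} (n log n)^{-s}` for complex `s`; the summation index is
shifted by two, and the powers have the positive real base `n log n`. -/
noncomputable def nLogNZeta (s : ℂ) : ℂ :=
  ∑' n : ℕ, ((((n + 2 : ℕ) : ℝ) * Real.log ((n + 2 : ℕ) : ℝ) : ℝ) : ℂ) ^ (-s)

/-- `C` is the constant term in `∑_{2 ≤ k < n} 1 / (k log k) = log log n + C + o(1)`. -/
def IsLogLogConstant (C : ℝ) : Prop :=
  Tendsto (fun n : ℕ => (∑ k ∈ Finset.Ico 2 n, 1 / ((k : ℝ) * Real.log k)) -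
    Real.log (Real.log n)) atTop (𝓝 C)

/-!
Put `s = 1 + w`. The increments of `y ↦ y^(-1-w) - y⁻¹` are dominated by the decrements of
`‖w‖ (log y + 2) / y`. Along `y = x log x` this bounds the difference between the sum and the
integral of `(x log x)^(-1-w) - (x log x)⁻¹` by `O(w)`, uniformly in `Re w > 0`, and the subtracted
`∑ 1 / (k log k)` supplies the constant `C + log log 2`.

With `t = log x` and `ψ(t) = t + log t`, what remains is `J(w) = ∫_L^∞ e^(-w ψ(t)) / t dt` for
`L = log 2`. Integrating `(e^(-w ψ))' = -w (1 + 1/t) e^(-w ψ)` from `L` to `∞` and completing the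
integral of `e^(-w ψ)` to Euler's integral `w ∫_0^∞ t^(-w) e^(-w t) dt = w^w Γ(1 - w)` gives
`w J(w) = e^(-w ψ(L)) + w ∫_0^L e^(-w ψ(t)) dt - w^w Γ(1 - w)`. The first two terms are analytic at
`w = 0`, equal to `1 - w log L + O(w²)`, and `w^w Γ(1 - w) = 1 + w log w + γ w + O(w² log² w)`, so
`J(w) = -log w - log L - γ + O(w log² w)`.
-/

open MeasureTheory ProbabilityTheory Set

section SumIntegralComparison

variable {E : Type*} [NormedAddCommGroup E] {f f' : ℝ → E} {g g' : ℝ → ℝ} {s : Set ℝ}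

/-- The increments of `f` on `s` are bounded in norm by the decrements of `g`. For real `f = g`
this says that `f` is antitone; in general it is how a majorant of the variation of a vector-valued
`f` is recorded. -/
def IncrementsDominatedOn (f : ℝ → E) (g : ℝ → ℝ) (s : Set ℝ) : Prop :=
  ∀ ⦃x⦄, x ∈ s → ∀ ⦃y⦄, y ∈ s → x ≤ y → ‖f y - f x‖ ≤ g x - g y

namespace IncrementsDominatedOn

theorem of_antitoneOn (hg : AntitoneOn g s) : IncrementsDominatedOn g g s := by
  intro x hx y hy hxy
  rw [Real.norm_of_nonpos (sub_nonpos.mpr (hg hx hy hxy)), neg_sub]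

theorem mono {t : Set ℝ} (h : IncrementsDominatedOn f g s) (hts : t ⊆ s) :
    IncrementsDominatedOn f g t :=
  fun _ hx _ hy hxy => h (hts hx) (hts hy) hxy

theorem antitoneOn (h : IncrementsDominatedOn f g s) : AntitoneOn g s :=
  fun _ hx _ hy hxy => sub_nonneg.mp ((norm_nonneg _).trans (h hx hy hxy))

theorem comp {t : Set ℝ} {u : ℝ → ℝ} (h : IncrementsDominatedOn f g s) (hu : MonotoneOn u t)
    (hts : MapsTo u t s) : IncrementsDominatedOn (f ∘ u) (g ∘ u) t :=
  fun _ hx _ hy hxy => h (hts hx) (hts hy) (hu hx hy hxy)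

variable [NormedSpace ℝ E]

theorem of_norm_deriv_le (hs : s.OrdConnected) (hf : ∀ x ∈ s, HasDerivAt f (f' x) x)
    (hg : ∀ x ∈ s, HasDerivAt g (g' x) x) (hfg : ∀ x ∈ s, ‖f' x‖ ≤ -g' x) :
    IncrementsDominatedOn f g s := by
  intro a ha b hb hab
  have hsub : Icc a b ⊆ s := hs.out ha hb
  have hF : ∀ x ∈ Icc a b, HasDerivAt (fun x => f x - f a) (f' x) x :=
    fun x hx => (hf x (hsub hx)).sub_const _
  have hG : ∀ x ∈ Icc a b, HasDerivAt (fun x => g a - g x) (-g' x) x :=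
    fun x hx => (hg x (hsub hx)).const_sub _
  exact image_norm_le_of_norm_deriv_right_le_deriv_boundary'
    (fun x hx => (hF x hx).continuousAt.continuousWithinAt)
    (fun x hx => (hF x (Ico_subset_Icc_self hx)).hasDerivWithinAt) (by simp)
    (fun x hx => (hG x hx).continuousAt.continuousWithinAt)
    (fun x hx => (hG x (Ico_subset_Icc_self hx)).hasDerivWithinAt)
    (fun x hx => hfg x (hsub (Ico_subset_Icc_self hx))) (right_mem_Icc.mpr hab)

variable [CompleteSpace E]

theorem norm_smul_sub_integral_le {a b : ℝ} (h : IncrementsDominatedOn f g (Icc a b))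
    (hab : a ≤ b) (hf : IntervalIntegrable f volume a b) :
    ‖(b - a) • f a - ∫ x in a..b, f x‖ ≤ (b - a) * (g a - g b) := by
  have ha : a ∈ Icc a b := left_mem_Icc.mpr hab
  have hb : b ∈ Icc a b := right_mem_Icc.mpr hab
  rw [← intervalIntegral.integral_const, ← intervalIntegral.integral_sub
    intervalIntegrable_const hf, mul_comm, ← abs_of_nonneg (sub_nonneg.mpr hab)]
  refine intervalIntegral.norm_integral_le_of_norm_le_const fun x hx => ?_
  rw [uIoc_of_le hab] at hx
  have hx' : x ∈ Icc a b := Ioc_subset_Icc_self hx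
  calc ‖f a - f x‖ = ‖f x - f a‖ := norm_sub_rev _ _
    _ ≤ g a - g x := h ha hx' hx'.1
    _ ≤ g a - g b := by gcongr; exact h.antitoneOn hx' hb hx'.2

theorem norm_sum_sub_integral_le {m n : ℕ} (h : IncrementsDominatedOn f g (Icc (m : ℝ) n))
    (hmn : m ≤ n) (hf : IntervalIntegrable f volume m n) :
    ‖∑ k ∈ Finset.Ico m n, f k - ∫ x in (m : ℝ)..n, f x‖ ≤ g m - g n := by
  have hsub : ∀ k ∈ Ico m n, Icc (k : ℝ) (k + 1 : ℕ) ⊆ Icc (m : ℝ) n := fun k hk =>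
    Icc_subset_Icc (by exact_mod_cast hk.1) (by exact_mod_cast hk.2)
  have hf' : ∀ k ∈ Ico m n, IntervalIntegrable f volume k (k + 1 : ℕ) := fun k hk =>
    hf.mono_set (by simpa only [uIcc_of_le, Nat.cast_le, hmn, k.le_succ] using hsub k hk)
  rw [← intervalIntegral.sum_integral_adjacent_intervals_Ico hmn hf', ← Finset.sum_sub_distrib]
  calc ‖∑ k ∈ Finset.Ico m n, (f k - ∫ x in (k : ℝ)..(k + 1 : ℕ), f x)‖
      ≤ ∑ k ∈ Finset.Ico m n, (g k - g (k + 1 : ℕ)) := by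
        refine norm_sum_le_of_le _ fun k hk => ?_
        rw [Finset.mem_Ico] at hk
        simpa using (h.mono (hsub k hk)).norm_smul_sub_integral_le (by simp) (hf' k hk)
    _ = g m - g n := by
        rw [← neg_inj, ← Finset.sum_neg_distrib]
        simpa using Finset.sum_Ico_sub (fun k : ℕ => g k) hmn

theorem exists_tendsto_sum_sub_integral {m : ℕ} (h : IncrementsDominatedOn f g (Ici (m : ℝ)))
    (hg : BddBelow (g '' Ici (m : ℝ)))
    (hf : ∀ n : ℕ, m ≤ n → IntervalIntegrable f volume m n) :
    ∃ l : E, Tendsto (fun n : ℕ => ∑ k ∈ Finset.Ico m n, f k - ∫ x in (m : ℝ)..n, f x)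
      atTop (𝓝 l) := by
  set u : ℕ → E := fun n => ∑ k ∈ Finset.Ico m n, f k - ∫ x in (m : ℝ)..n, f x
  have hmem (i : ℕ) : ((i + m : ℕ) : ℝ) ∈ Ici (m : ℝ) := by simp
  have hanti : Antitone fun i : ℕ => g (i + m : ℕ) := fun i j hij =>
    h.antitoneOn (hmem i) (hmem j) (by gcongr)
  have hbdd : BddBelow (range fun i : ℕ => g (i + m : ℕ)) :=
    hg.mono (range_subset_iff.mpr fun i => mem_image_of_mem g (hmem i))
  have hdist (i j : ℕ) (hij : i ≤ j) :
      dist (u (i + m)) (u (j + m)) ≤ g (i + m : ℕ) - ⨅ i : ℕ, g (i + m : ℕ) := by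
    have hi := hf (i + m) (Nat.le_add_left m i)
    have hij' := hi.symm.trans (hf (j + m) (Nat.le_add_left m j))
    have hle : i + m ≤ j + m := by gcongr
    have hincr : u (j + m) - u (i + m) = ∑ k ∈ Finset.Ico (i + m) (j + m), f k -
        ∫ x in ((i + m : ℕ) : ℝ)..(j + m : ℕ), f x := by
      simp only [u]
      rw [← Finset.sum_Ico_consecutive (fun k : ℕ => f k) (Nat.le_add_left m i) hle,
        ← intervalIntegral.integral_add_adjacent_intervals hi hij']
      abel
    rw [dist_comm, dist_eq_norm, hincr]
    have hsub : Icc ((i + m : ℕ) : ℝ) (j + m : ℕ) ⊆ Ici (m : ℝ) :=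
      Icc_subset_Ici_self.trans (Ici_subset_Ici.mpr (hmem i))
    calc _ ≤ g (i + m : ℕ) - g (j + m : ℕ) := (h.mono hsub).norm_sum_sub_integral_le hle hij'
      _ ≤ _ := by gcongr; exact ciInf_le hbdd j
  have hcauchy : CauchySeq fun i => u (i + m) :=
    cauchySeq_of_le_tendsto_0' _ hdist
      (tendsto_sub_nhds_zero_iff.mpr (tendsto_atTop_ciInf hanti hbdd))
  obtain ⟨l, hl⟩ := cauchySeq_tendsto_of_complete hcauchy
  exact ⟨l, (tendsto_add_atTop_iff_nat m).mp hl⟩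

end IncrementsDominatedOn

end SumIntegralComparison

/-! ### Taylor remainders, the identity theorem and `w ^ w * Γ (1 - w)` -/

theorem isBigO_sub_sub_deriv_smul {𝕜 E : Type*} [NontriviallyNormedField 𝕜] [NormedAddCommGroup E]
    [NormedSpace 𝕜 E] {f : 𝕜 → E} {c : 𝕜} (hf : AnalyticAt 𝕜 f c) :
    (fun z => f (c + z) - f c - z • deriv f c) =O[𝓝 0] fun z => z ^ 2 := by
  obtain ⟨p, hp⟩ := hf
  have htaylor := (hp.isBigO_sub_partialSum_pow 2).congr_right fun z => (norm_pow z 2).symm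
  refine htaylor.of_norm_right.congr_left fun z => ?_
  rw [FormalMultilinearSeries.partialSum, Finset.sum_range_succ, Finset.sum_range_one,
    hp.coeff_zero, hp.deriv, FormalMultilinearSeries.apply_eq_pow_smul_coeff, pow_one, sub_sub,
    FormalMultilinearSeries.coeff]
  rfl

theorem eqOn_of_preconnected_of_eventually_ofReal_eq {E : Type*} [NormedAddCommGroup E]
    [NormedSpace ℂ E] {f g : ℂ → E} {U : Set ℂ} {x : ℝ} (hf : AnalyticOnNhd ℂ f U)
    (hg : AnalyticOnNhd ℂ g U) (hU : IsPreconnected U) (hx : (x : ℂ) ∈ U)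
    (hfg : ∀ᶠ r : ℝ in 𝓝 x, f r = g r) : EqOn f g U := by
  have hofReal : Tendsto Complex.ofReal (𝓝[≠] x) (𝓝[≠] (x : ℂ)) :=
    Complex.continuous_ofReal.continuousAt.continuousWithinAt.tendsto_nhdsWithin
      fun r hr => by simpa using hr
  exact hf.eqOn_of_preconnected_of_frequently_eq hg hU hx
    (hofReal.frequently (hfg.filter_mono nhdsWithin_le_nhds).frequently)

theorem norm_exp_neg_sub_one_le {z : ℂ} (hz : 0 ≤ z.re) : ‖Complex.exp (-z) - 1‖ ≤ ‖z‖ := by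
  have hbound : ∀ x ∈ {x : ℂ | x.re ≤ 0}, ‖Complex.exp x‖ ≤ 1 := fun x hx => by
    rwa [Complex.norm_exp, Real.exp_le_one_iff]
  simpa using (convex_halfSpace_re_le 0).norm_image_sub_le_of_norm_hasDerivWithin_le
    (fun x _ => (Complex.hasDerivAt_exp x).hasDerivWithinAt) hbound (x := 0) (y := -z)
    (by simp) (by simpa using hz)

theorem ofReal_cpow_eq_exp {y : ℝ} (hy : 0 < y) (z : ℂ) :
    (y : ℂ) ^ z = Complex.exp (z * Real.log y) := by
  rw [Complex.cpow_def_of_ne_zero (by exact_mod_cast hy.ne'), ← Complex.ofReal_log hy.le, mul_comm]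

theorem nhdsWithin_re_pos_le_nhdsNE : 𝓝[{w : ℂ | 0 < w.re}] 0 ≤ 𝓝[≠] 0 :=
  nhdsWithin_mono 0 fun _ => Complex.ne_zero_of_re_pos

theorem tendsto_mul_log_nhds_zero : Tendsto (fun w : ℂ => w * Complex.log w) (𝓝 0) (𝓝 0) := by
  have hbound (w : ℂ) : ‖w * Complex.log w‖ ≤ |‖w‖ * Real.log ‖w‖| + ‖w‖ * Real.pi := by
    rw [norm_mul, abs_mul, abs_norm, ← mul_add, ← Complex.log_re]
    have him : |(Complex.log w).im| ≤ Real.pi := by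
      rw [Complex.log_im]
      exact Complex.abs_arg_le_pi w
    gcongr
    exact (Complex.norm_le_abs_re_add_abs_im _).trans (by gcongr)
  have hcont : Continuous fun w : ℂ => |‖w‖ * Real.log ‖w‖| + ‖w‖ * Real.pi :=
    (Real.continuous_mul_log.comp continuous_norm).abs.add (by fun_prop)
  exact squeeze_zero_norm hbound (by simpa using hcont.tendsto 0)

theorem one_isBigO_log : (fun _ : ℂ => (1 : ℂ)) =O[𝓝[≠] 0] Complex.log := by
  have hlog : Tendsto (fun w : ℂ => Real.log ‖w‖) (𝓝[≠] 0) atBot :=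
    Real.tendsto_log_nhdsGT_zero.comp tendsto_norm_nhdsNE_zero
  refine .of_bound 1 ?_
  filter_upwards [hlog.eventually_le_atBot (-1)] with w hw
  have hre := Complex.abs_re_le_norm (Complex.log w)
  rw [Complex.log_re, abs_of_nonpos (by linarith)] at hre
  rw [norm_one, one_mul]
  linarith

theorem isBigO_mul_log_sq (f : ℂ → ℂ) : f =O[𝓝[≠] 0] fun w => f w * Complex.log w ^ 2 := by
  simpa using (isBigO_refl f _).mul (one_isBigO_log.pow 2)

theorem analyticAt_Gamma_of_re_pos {z : ℂ} (hz : 0 < z.re) : AnalyticAt ℂ Complex.Gamma z := by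
  rw [Complex.analyticAt_iff_eventually_differentiableAt]
  filter_upwards [(isOpen_lt continuous_const Complex.continuous_re).mem_nhds hz]
    with y (hy : 0 < y.re)
  refine Complex.differentiableAt_Gamma y fun m hm => hy.not_ge ?_
  rw [hm, Complex.neg_re, Complex.natCast_re]
  exact neg_nonpos.mpr m.cast_nonneg

theorem hasDerivAt_Gamma_one_sub :
    HasDerivAt (fun w : ℂ => Complex.Gamma (1 - w)) Real.eulerMascheroniConstant 0 := by
  have hGamma : HasDerivAt Complex.Gamma (-Real.eulerMascheroniConstant : ℂ) (1 - 0) := by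
    simpa only [sub_zero] using Complex.hasDerivAt_Gamma_one
  simpa only [neg_neg] using hGamma.comp_const_sub 1 0

theorem Gamma_one_sub_isBigO :
    (fun w : ℂ => Complex.Gamma (1 - w) - 1 - w * Real.eulerMascheroniConstant)
      =O[𝓝 0] fun w => w ^ 2 := by
  have han : AnalyticAt ℂ (fun w : ℂ => Complex.Gamma (1 - w)) 0 :=
    (analyticAt_Gamma_of_re_pos (by simp)).comp (g := Complex.Gamma)
      (analyticAt_const.sub analyticAt_id)
  simpa [hasDerivAt_Gamma_one_sub.deriv] using isBigO_sub_sub_deriv_smul han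

theorem exp_sub_one_sub_self_isBigO :
    (fun z : ℂ => Complex.exp z - 1 - z) =O[𝓝 0] fun z => z ^ 2 := by
  simpa using isBigO_sub_sub_deriv_smul (analyticAt_cexp (z := 0))

theorem cpow_self_mul_Gamma_isBigO :
    (fun w : ℂ => w ^ w * Complex.Gamma (1 - w) - 1 - w * Complex.log w
        - w * Real.eulerMascheroniConstant)
      =O[𝓝[≠] 0] fun w => w ^ 2 * Complex.log w ^ 2 := by
  have hle : 𝓝[≠] (0 : ℂ) ≤ 𝓝 0 := nhdsWithin_le_nhds
  have hpow : (fun w : ℂ => w ^ w - 1 - w * Complex.log w) =O[𝓝[≠] 0]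
      fun w => w ^ 2 * Complex.log w ^ 2 := by
    refine (exp_sub_one_sub_self_isBigO.comp_tendsto
      (tendsto_mul_log_nhds_zero.mono_left hle)).congr' ?_ (.of_forall fun w => mul_pow _ _ _)
    filter_upwards [self_mem_nhdsWithin] with w hw
    rw [Complex.cpow_def_of_ne_zero hw, mul_comm (Complex.log w)]
    rfl
  have hbdd : (fun w : ℂ => Complex.Gamma (1 - w)) =O[𝓝[≠] 0] fun _ => (1 : ℂ) :=
    (hasDerivAt_Gamma_one_sub.continuousAt.tendsto.isBigO_one ℂ).mono hle
  have hsub : (fun w : ℂ => w * Complex.log w * (Complex.Gamma (1 - w) - 1)) =O[𝓝[≠] 0]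
      fun w => w ^ 2 * Complex.log w ^ 2 := by
    have hGamma : (fun w : ℂ => Complex.Gamma (1 - w) - 1) =O[𝓝[≠] 0] fun w => w := by
      simpa using hasDerivAt_Gamma_one_sub.isBigO_sub.mono hle
    refine (((isBigO_refl _ _).mul hGamma).mul one_isBigO_log).congr
      (fun w => mul_one _) fun w => ?_
    ring
  refine ((((hpow.mul hbdd).congr_right fun w => mul_one _).add hsub).add
    ((Gamma_one_sub_isBigO.mono hle).trans (isBigO_mul_log_sq _))).congr_left fun w => ?_
  ring

/-! ### Comparison of the series with an integral -/

theorem monotoneOn_mul_log : MonotoneOn (fun x : ℝ => x * Real.log x) (Ici 1) :=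
  Real.mul_log_strictMonoOn.monotoneOn.mono
    (Ici_subset_Ici.mpr (Real.exp_le_one_iff.mpr (by norm_num)))

theorem one_le_mul_log {x : ℝ} (hx : 2 ≤ x) : 1 ≤ x * Real.log x := by
  have hlog : Real.log 2 ≤ Real.log x := Real.log_le_log two_pos hx
  nlinarith [Real.log_two_gt_d9]

theorem antitoneOn_one_div_mul_log : AntitoneOn (fun x : ℝ => 1 / (x * Real.log x)) (Ioi 1) :=
  fun _ hx _ hy hxy => one_div_le_one_div_of_le
    (mul_pos (zero_lt_one.trans hx) (Real.log_pos hx))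
    (monotoneOn_mul_log (mem_Ici.mpr hx.le) (mem_Ici.mpr hy.le) hxy)

theorem hasDerivAt_log_log {x : ℝ} (hx : 1 < x) :
    HasDerivAt (fun x => Real.log (Real.log x)) (1 / (x * Real.log x)) x := by
  have hlog := (Real.hasDerivAt_log (zero_lt_one.trans hx).ne').log (Real.log_pos hx).ne'
  rwa [inv_div_left, inv_eq_one_div, mul_comm] at hlog

theorem intervalIntegrable_one_div_mul_log {a b : ℝ} (ha : 1 < a) (hb : 1 < b) :
    IntervalIntegrable (fun x => 1 / (x * Real.log x)) volume a b :=
  (antitoneOn_one_div_mul_log.mono fun _ hx =>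
    (lt_min ha hb).trans_le hx.1).intervalIntegrable

theorem integral_one_div_mul_log {a b : ℝ} (ha : 1 < a) (hb : 1 < b) :
    ∫ x in a..b, 1 / (x * Real.log x) = Real.log (Real.log b) - Real.log (Real.log a) :=
  intervalIntegral.integral_eq_sub_of_hasDerivAt
    (fun _ hx => hasDerivAt_log_log ((lt_min ha hb).trans_le hx.1))
    (intervalIntegrable_one_div_mul_log ha hb)

theorem exists_isLogLogConstant : ∃ C : ℝ, IsLogLogConstant C := by
  have hanti : AntitoneOn (fun x : ℝ => 1 / (x * Real.log x)) (Ici (2 : ℕ)) :=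
    antitoneOn_one_div_mul_log.mono fun x hx => lt_of_lt_of_le (by norm_num) (mem_Ici.mp hx)
  have hbdd : BddBelow ((fun x : ℝ => 1 / (x * Real.log x)) '' Ici (2 : ℕ)) := by
    refine ⟨0, forall_mem_image.mpr fun x hx => one_div_nonneg.mpr ?_⟩
    exact zero_le_one.trans (one_le_mul_log (by simpa using hx))
  have hone {n : ℕ} (hn : 2 ≤ n) : (1 : ℝ) < n := by exact_mod_cast hn
  obtain ⟨l, hl⟩ := (IncrementsDominatedOn.of_antitoneOn hanti).exists_tendsto_sum_sub_integral
    hbdd fun n hn => intervalIntegrable_one_div_mul_log (hone le_rfl) (hone hn)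
  refine ⟨l - Real.log (Real.log (2 : ℕ)), (hl.sub_const _).congr' ?_⟩
  filter_upwards [eventually_ge_atTop 2] with n hn
  rw [integral_one_div_mul_log (hone le_rfl) (hone hn)]
  ring

theorem summable_mul_log_cpow_neg {s : ℂ} (hs : 1 < s.re) :
    Summable (fun n : ℕ =>
      ((((n + 2 : ℕ) : ℝ) * Real.log ((n + 2 : ℕ) : ℝ) : ℝ) : ℂ) ^ (-s)) := by
  have hsum : Summable fun n : ℕ => ((n + 2 : ℕ) : ℝ) ^ (-s.re) * (Real.log 2) ^ (-s.re) :=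
    ((summable_nat_add_iff 2).mpr
      (Real.summable_nat_rpow.mpr (show -s.re < -1 by linarith))).mul_right _
  refine hsum.of_norm_bounded fun n => ?_
  have hlog2 : 0 < Real.log 2 := Real.log_pos one_lt_two
  have hlog : Real.log 2 ≤ Real.log ((n + 2 : ℕ) : ℝ) :=
    Real.log_le_log two_pos (by push_cast; linarith [n.cast_nonneg (α := ℝ)])
  have hpos : 0 < Real.log ((n + 2 : ℕ) : ℝ) := hlog2.trans_le hlog
  rw [Complex.norm_cpow_eq_rpow_re_of_pos (by positivity), Complex.neg_re,
    Real.mul_rpow (by positivity) hpos.le]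
  exact mul_le_mul_of_nonneg_left
    (Real.rpow_le_rpow_of_nonpos hlog2 hlog (by linarith)) (by positivity)

theorem norm_one_sub_mul_cpow_neg_le {w : ℂ} (hw : 0 ≤ w.re) {y : ℝ} (hy : 1 ≤ y) :
    ‖1 - (1 + w) * (y : ℂ) ^ (-w)‖ ≤ ‖w‖ * (Real.log y + 1) := by
  have hlog : 0 ≤ Real.log y := Real.log_nonneg hy
  have hsub : ‖(y : ℂ) ^ (-w) - 1‖ ≤ ‖w‖ * Real.log y := by
    have := norm_exp_neg_sub_one_le (z := w * Real.log y) (by simpa using mul_nonneg hw hlog)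
    rwa [← neg_mul, ← ofReal_cpow_eq_exp (by linarith), norm_mul, Complex.norm_real,
      Real.norm_of_nonneg hlog] at this
  have hle : ‖(y : ℂ) ^ (-w)‖ ≤ 1 := by
    rw [Complex.norm_cpow_eq_rpow_re_of_pos (by linarith)]
    exact Real.rpow_le_one_of_one_le_of_nonpos hy (by simpa using hw)
  calc ‖1 - (1 + w) * (y : ℂ) ^ (-w)‖ = ‖((y : ℂ) ^ (-w) - 1) + w * (y : ℂ) ^ (-w)‖ := by
        rw [← norm_neg]; ring_nf
    _ ≤ ‖w‖ * Real.log y + ‖w‖ * 1 := by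
        refine norm_add_le_of_le hsub ?_
        rw [norm_mul]
        gcongr
    _ = ‖w‖ * (Real.log y + 1) := by ring

theorem incrementsDominatedOn_cpow_sub_inv {w : ℂ} (hw : 0 ≤ w.re) :
    IncrementsDominatedOn (fun y : ℝ => (y : ℂ) ^ (-(1 + w)) - (y : ℂ)⁻¹)
      (fun y => ‖w‖ * ((Real.log y + 2) / y)) (Ici 1) := by
  have hexp : -(1 + w) ≠ 0 :=
    neg_ne_zero.mpr (Complex.ne_zero_of_re_pos (by rw [Complex.add_re, Complex.one_re]; linarith))
  have hpos {y : ℝ} (hy : y ∈ Ici 1) : 0 < y := zero_lt_one.trans_le hy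
  refine .of_norm_deriv_le (f' := fun y => ((y ^ 2)⁻¹ : ℝ) * (1 - (1 + w) * (y : ℂ) ^ (-w)))
    (g' := fun y => -(‖w‖ * ((Real.log y + 1) / y ^ 2))) ordConnected_Ici
    (fun y hy => ?_) (fun y hy => ?_) fun y hy => ?_
  · have hy0 : (y : ℂ) ≠ 0 := by exact_mod_cast (hpos hy).ne'
    have hinv : HasDerivAt (fun y : ℝ => (y : ℂ)⁻¹) (-1 / (y : ℂ) ^ 2) y :=
      ((hasDerivAt_id y).ofReal_comp).inv hy0
    refine ((hasDerivAt_ofReal_cpow_const (hpos hy).ne' hexp).sub hinv).congr_deriv ?_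
    rw [show -(1 + w) - 1 = -w - 2 by ring, Complex.cpow_sub _ _ hy0, Complex.cpow_ofNat]
    push_cast
    field_simp
    ring
  · have hder := ((Real.hasDerivAt_log (hpos hy).ne').add_const 2).div (hasDerivAt_id y)
      (hpos hy).ne'
    refine (hder.const_mul ‖w‖).congr_deriv ?_
    have := (hpos hy).ne'
    simp only [id]
    field_simp
    ring
  · rw [neg_neg, norm_mul, Complex.norm_real, Real.norm_of_nonneg (by positivity)]
    calc _ ≤ (y ^ 2)⁻¹ * (‖w‖ * (Real.log y + 1)) := by
          gcongr
          exact norm_one_sub_mul_cpow_neg_le hw hy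
      _ = _ := by ring

/-- The function `log (t eᵗ)`, that is `log (x log x)` in the variable `t = log x`. -/
noncomputable def logMulExp (t : ℝ) : ℝ := t + Real.log t

theorem logMulExp_log {x : ℝ} (hx : 1 < x) :
    logMulExp (Real.log x) = Real.log (x * Real.log x) :=
  (Real.log_mul (by positivity) (Real.log_pos hx).ne').symm

theorem hasDerivAt_logMulExp {t : ℝ} (ht : t ≠ 0) : HasDerivAt logMulExp (1 + t⁻¹) t :=
  (hasDerivAt_id t).add (Real.hasDerivAt_log ht)

theorem exp_mul_logMulExp {t : ℝ} (ht : 0 < t) (r : ℝ) :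
    Real.exp (r * logMulExp t) = t ^ r * Real.exp (r * t) := by
  rw [logMulExp, Real.rpow_def_of_pos ht, ← Real.exp_add]
  ring_nf

theorem norm_cexp_neg_mul_logMulExp {t : ℝ} (ht : 0 < t) (w : ℂ) :
    ‖Complex.exp (-w * logMulExp t)‖ = t ^ (-w.re) * Real.exp (-w.re * t) := by
  rw [Complex.norm_exp, Complex.re_mul_ofReal, Complex.neg_re, exp_mul_logMulExp ht]

theorem ofReal_mul_log_cpow {x : ℝ} (hx : 1 < x) (w : ℂ) :
    ((x * Real.log x : ℝ) : ℂ) ^ (-(1 + w)) =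
      (x⁻¹ : ℝ) • (Complex.exp (-w * logMulExp (Real.log x)) / Real.log x) := by
  have hpos : 0 < x * Real.log x := mul_pos (by positivity) (Real.log_pos hx)
  rw [neg_add', Complex.cpow_sub _ _ (by exact_mod_cast hpos.ne'), Complex.cpow_neg_one,
    logMulExp_log hx, neg_mul, Complex.exp_neg, ← ofReal_cpow_eq_exp hpos,
    Complex.real_smul]
  push_cast
  ring

theorem continuousOn_cexp_mul_logMulExp_div (z : ℂ) :
    ContinuousOn (fun t : ℝ => Complex.exp (z * logMulExp t) / t) (Ioi 0) := fun t ht =>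
  (ContinuousAt.div₀ ((((hasDerivAt_logMulExp ht.ne').continuousAt.ofReal).const_mul z).cexp)
    Complex.continuous_ofReal.continuousAt (by exact_mod_cast ht.ne')).continuousWithinAt

theorem integrableOn_cexp_neg_mul_logMulExp_div {w : ℂ} (hw : 0 < w.re) {L : ℝ} (hL : 0 < L) :
    IntegrableOn (fun t : ℝ => Complex.exp (-w * logMulExp t) / t) (Ioi L) := by
  have hsub : Ioi L ⊆ Ioi 0 := Ioi_subset_Ioi hL.le
  refine (integrableOn_Ioi_rpow_of_lt (show -w.re - 1 < -1 by linarith) hL).mono'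
    (((continuousOn_cexp_mul_logMulExp_div (-w)).mono hsub).aestronglyMeasurable
      measurableSet_Ioi) ((ae_restrict_iff' measurableSet_Ioi).mpr (.of_forall fun t ht => ?_))
  have ht0 : 0 < t := hsub ht
  rw [norm_div, norm_cexp_neg_mul_logMulExp ht0, Complex.norm_real, Real.norm_of_nonneg ht0.le,
    Real.rpow_sub_one ht0.ne']
  gcongr
  refine mul_le_of_le_one_right (by positivity) (Real.exp_le_one_iff.mpr ?_)
  nlinarith

theorem integral_mul_log_cpow {a b : ℝ} (ha : 1 < a) (hb : 1 < b) (w : ℂ) :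
    ∫ x in a..b, ((x * Real.log x : ℝ) : ℂ) ^ (-(1 + w)) =
      ∫ t in Real.log a..Real.log b, Complex.exp (-w * logMulExp t) / t := by
  have hone {x : ℝ} (hx : x ∈ uIcc a b) : 1 < x := (lt_min ha hb).trans_le hx.1
  have hne {x : ℝ} (hx : x ∈ uIcc a b) : x ≠ 0 := (zero_lt_one.trans (hone hx)).ne'
  rw [← intervalIntegral.integral_deriv_smul_comp' (f' := fun x => x⁻¹)
    (fun x hx => Real.hasDerivAt_log (hne hx)) (continuousOn_inv₀.mono fun x hx => hne hx)
    ((continuousOn_cexp_mul_logMulExp_div (-w)).mono ?_)]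
  · exact intervalIntegral.integral_congr fun x hx => ofReal_mul_log_cpow (hone hx) w
  · exact image_subset_iff.mpr fun x hx => Real.log_pos (hone hx)

theorem intervalIntegrable_mul_log_cpow {a b : ℝ} (ha : 1 < a) (hb : 1 < b) (z : ℂ) :
    IntervalIntegrable (fun x : ℝ => ((x * Real.log x : ℝ) : ℂ) ^ z) volume a b := by
  refine ContinuousOn.intervalIntegrable fun x hx => ContinuousAt.continuousWithinAt ?_
  have hx1 : 1 < x := (lt_min ha hb).trans_le hx.1
  have hpos : 0 < x * Real.log x := mul_pos (by positivity) (Real.log_pos hx1)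
  exact (Complex.continuous_ofReal.comp Real.continuous_mul_log).continuousAt.cpow
    continuousAt_const (Complex.ofReal_mem_slitPlane.mpr hpos)

theorem norm_sum_mul_log_cpow_sub_integral_le {w : ℂ} (hw : 0 ≤ w.re) {n : ℕ} (hn : 2 ≤ n) :
    ‖∑ k ∈ Finset.Ico 2 n, ((k * Real.log k : ℝ) : ℂ) ^ (-(1 + w)) -
        ((∑ k ∈ Finset.Ico 2 n, 1 / (k * Real.log k) - Real.log (Real.log n) : ℝ) : ℂ) -
        Real.log (Real.log 2) -
        ∫ t in Real.log 2..Real.log n, Complex.exp (-w * logMulExp t) / t‖ ≤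
      ‖w‖ * ((Real.log (2 * Real.log 2) + 2) / (2 * Real.log 2)) := by
  have hone : (1 : ℝ) < n := by exact_mod_cast hn
  have hdom := (incrementsDominatedOn_cpow_sub_inv hw).comp (t := Icc (2 : ℕ) n)
    (monotoneOn_mul_log.mono fun x hx => one_le_two.trans (by simpa using hx.1))
    fun x hx => one_le_mul_log (by simpa using hx.1)
  have hcpow := intervalIntegrable_mul_log_cpow one_lt_two hone
  have hinv : IntervalIntegrable (fun x : ℝ => ((x * Real.log x : ℝ) : ℂ)⁻¹) volume 2 n := by
    simpa only [Complex.cpow_neg_one] using hcpow (-1)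
  have hint : ∫ x in (2 : ℝ)..n, ((x * Real.log x : ℝ) : ℂ)⁻¹ =
      Real.log (Real.log n) - Real.log (Real.log 2) := by
    rw [← Complex.ofReal_sub, ← integral_one_div_mul_log one_lt_two hone,
      ← intervalIntegral.integral_ofReal]
    simp only [Complex.ofReal_inv, one_div]
  have hbound := hdom.norm_sum_sub_integral_le hn ((hcpow (-(1 + w))).sub hinv)
  simp only [Function.comp_apply, Finset.sum_sub_distrib, Nat.cast_ofNat] at hbound
  rw [intervalIntegral.integral_sub (hcpow _) hinv, hint,
    integral_mul_log_cpow one_lt_two hone] at hbound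
  refine (congrArg norm ?_).trans_le (hbound.trans (sub_le_self _ ?_))
  · push_cast [one_div]
    ring
  · have : 1 ≤ n * Real.log n := one_le_mul_log (by exact_mod_cast hn)
    have := Real.log_nonneg this
    positivity

theorem nLogNZeta_one_add_sub_integral_isBigO {C : ℝ} (hC : IsLogLogConstant C) :
    (fun w => nLogNZeta (1 + w) - C - Real.log (Real.log 2) -
        ∫ t in Ioi (Real.log 2), Complex.exp (-w * logMulExp t) / t)
      =O[𝓟 {w | 0 < w.re}] fun w => w := by
  refine .of_bound ((Real.log (2 * Real.log 2) + 2) / (2 * Real.log 2))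
    (eventually_principal.mpr fun w hw => ?_)
  have hw' : 1 < (1 + w).re := by simpa using hw
  have hsum : Tendsto (fun n : ℕ => ∑ k ∈ Finset.Ico 2 n, ((k * Real.log k : ℝ) : ℂ) ^ (-(1 + w)))
      atTop (𝓝 (nLogNZeta (1 + w))) := by
    rw [← tendsto_add_atTop_iff_nat 2]
    simpa only [nLogNZeta, Finset.sum_Ico_eq_sum_range, Nat.add_sub_cancel, add_comm 2] using
      (summable_mul_log_cpow_neg hw').hasSum.tendsto_sum_nat
  have hlog : Tendsto (fun n : ℕ => Real.log n) atTop atTop :=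
    Real.tendsto_log_atTop.comp tendsto_natCast_atTop_atTop
  have hint := intervalIntegral_tendsto_integral_Ioi (Real.log 2)
    (integrableOn_cexp_neg_mul_logMulExp_div hw (Real.log_pos one_lt_two)) hlog
  rw [mul_comm]
  refine le_of_tendsto (((hsum.sub hC.ofReal).sub_const _).sub hint).norm ?_
  filter_upwards [eventually_ge_atTop 2] with n hn
  exact norm_sum_mul_log_cpow_sub_integral_le hw.le hn

/-! ### Expansion of the integral -/

theorem mem_interior_integrableExpSet_logMulExp_Ioi {r : ℝ} (hr : r ∈ Ioo (-1) 0) :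
    r ∈ interior (integrableExpSet logMulExp (volume.restrict (Ioi 0))) := by
  refine interior_maximal (fun r hr => ?_) isOpen_Ioo hr
  refine (integrableOn_rpow_mul_exp_neg_mul_rpow hr.1 one_pos (neg_pos.mpr hr.2)).congr_fun
    (fun t ht => ?_) measurableSet_Ioi
  simp only [exp_mul_logMulExp ht, Real.rpow_one, neg_neg]

theorem mem_interior_integrableExpSet_logMulExp_Ioc {r : ℝ} (hr : -1 < r) (L : ℝ) :
    r ∈ interior (integrableExpSet logMulExp (volume.restrict (Ioc 0 L))) := by
  refine interior_maximal (fun r hr => ?_) isOpen_Ioi (mem_Ioi.mpr hr)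
  have hint : IntervalIntegrable (fun t => t ^ r * Real.exp (r * t)) volume 0 L :=
    (intervalIntegral.intervalIntegrable_rpow' hr).mul_continuousOn (by fun_prop)
  exact hint.1.congr_fun (fun t ht => (exp_mul_logMulExp ht.1 r).symm) measurableSet_Ioc

-- Here `mgf` and `complexMGF` are just Laplace transforms: the measure is infinite.
theorem mul_mgf_logMulExp_Ioi {r : ℝ} (hr : r ∈ Ioo 0 1) :
    r * mgf logMulExp (volume.restrict (Ioi 0)) (-r) = r ^ r * Real.Gamma (1 - r) := by
  have hint := Real.integral_rpow_mul_exp_neg_mul_Ioi (sub_pos.mpr hr.2) hr.1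
  have hmgf : mgf logMulExp (volume.restrict (Ioi 0)) (-r) =
      ∫ t in Ioi 0, t ^ (1 - r - 1) * Real.exp (-(r * t)) :=
    setIntegral_congr_fun measurableSet_Ioi fun t ht => by
      rw [exp_mul_logMulExp ht, sub_sub_cancel_left, neg_mul]
  rw [hmgf, hint, one_div, Real.inv_rpow hr.1.le, Real.rpow_sub hr.1, Real.rpow_one]
  have := hr.1.ne'
  field_simp

theorem mul_complexMGF_logMulExp_Ioi {w : ℂ} (hw : w.re ∈ Ioo 0 1) :
    w * complexMGF logMulExp (volume.restrict (Ioi 0)) (-w) = w ^ w * Complex.Gamma (1 - w) := by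
  have hleft : AnalyticOnNhd ℂ (fun w =>
      w * complexMGF logMulExp (volume.restrict (Ioi 0)) (-w)) (Complex.re ⁻¹' Ioo 0 1) := by
    refine fun z hz => analyticAt_id.mul ((analyticAt_complexMGF ?_).comp analyticAt_id.neg)
    exact mem_interior_integrableExpSet_logMulExp_Ioi (by simpa [and_comm] using hz)
  have hright : AnalyticOnNhd ℂ (fun w => w ^ w * Complex.Gamma (1 - w))
      (Complex.re ⁻¹' Ioo 0 1) := by
    refine fun z hz => (analyticAt_id.cpow analyticAt_id (.inl hz.1)).mul ?_
    exact (analyticAt_Gamma_of_re_pos (by simpa using hz.2)).comp (g := Complex.Gamma)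
      (analyticAt_const.sub analyticAt_id)
  have hreal : ∀ r ∈ Ioo (0 : ℝ) 1, (r : ℂ) * complexMGF logMulExp (volume.restrict (Ioi 0)) (-r) =
      (r : ℂ) ^ (r : ℂ) * Complex.Gamma (1 - r) := by
    intro r hr
    have hmgf := congrArg Complex.ofReal (mul_mgf_logMulExp_Ioi hr)
    rw [Complex.ofReal_mul, Complex.ofReal_mul, ← complexMGF_ofReal, Complex.ofReal_cpow hr.1.le,
      ← Complex.Gamma_ofReal] at hmgf
    exact_mod_cast hmgf
  have hmem : (1 / 2 : ℝ) ∈ Ioo (0 : ℝ) 1 := by norm_num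
  exact eqOn_of_preconnected_of_eventually_ofReal_eq hleft hright
    ((convex_Ioo 0 1).linear_preimage Complex.reLm).isPreconnected hmem
    (eventually_of_mem (isOpen_Ioo.mem_nhds hmem) hreal) hw

theorem tendsto_cexp_neg_mul_logMulExp_atTop {w : ℂ} (hw : 0 < w.re) :
    Tendsto (fun t => Complex.exp (-w * logMulExp t)) atTop (𝓝 0) := by
  have hψ : Tendsto logMulExp atTop atTop := tendsto_id.atTop_add_atTop Real.tendsto_log_atTop
  rw [tendsto_zero_iff_norm_tendsto_zero]
  simpa only [Complex.norm_exp, Complex.re_mul_ofReal, Complex.neg_re, Function.comp_def] using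
    Real.tendsto_exp_atBot.comp (hψ.const_mul_atTop_of_neg (neg_lt_zero.mpr hw))

theorem integrableOn_cexp_neg_mul_logMulExp {w : ℂ} (hw : w.re ∈ Ioo 0 1) :
    IntegrableOn (fun t => Complex.exp (-w * logMulExp t)) (Ioi 0) :=
  integrable_cexp_mul_of_re_mem_interior_integrableExpSet (z := -w)
    (mem_interior_integrableExpSet_logMulExp_Ioi (by simpa [and_comm] using hw))

theorem mul_integral_cexp_div_eq_sub_mul_integral_cexp {w : ℂ} (hw : w.re ∈ Ioo 0 1) {L : ℝ}
    (hL : 0 < L) :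
    w * ∫ t in Ioi L, Complex.exp (-w * logMulExp t) / t =
      Complex.exp (-w * logMulExp L) - w * ∫ t in Ioi L, Complex.exp (-w * logMulExp t) := by
  have hderiv : ∀ t ∈ Ici L, HasDerivAt (fun t => Complex.exp (-w * logMulExp t))
      (-w * (Complex.exp (-w * logMulExp t) + Complex.exp (-w * logMulExp t) / t)) t := by
    intro t ht
    have hψ := (hasDerivAt_logMulExp (hL.trans_le ht).ne').ofReal_comp
    refine (hψ.const_mul (-w)).cexp.congr_deriv ?_
    push_cast
    ring
  have hexp := (integrableOn_cexp_neg_mul_logMulExp hw).mono_set (Ioi_subset_Ioi hL.le)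
  have hdiv := integrableOn_cexp_neg_mul_logMulExp_div hw.1 hL
  have hint := integral_Ioi_of_hasDerivAt_of_tendsto' hderiv ((hexp.add hdiv).const_mul (-w))
    (tendsto_cexp_neg_mul_logMulExp_atTop hw.1)
  rw [integral_const_mul, integral_add hexp hdiv] at hint
  linear_combination -hint

theorem mul_integral_cexp_div_eq_sub_cpow_mul_Gamma {w : ℂ} (hw : w.re ∈ Ioo 0 1) {L : ℝ}
    (hL : 0 < L) :
    w * ∫ t in Ioi L, Complex.exp (-w * logMulExp t) / t =
      Complex.exp (-w * logMulExp L) + w * complexMGF logMulExp (volume.restrict (Ioc 0 L)) (-w) -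
        w ^ w * Complex.Gamma (1 - w) := by
  have hexp := integrableOn_cexp_neg_mul_logMulExp hw
  have hsplit := setIntegral_union (Ioc_disjoint_Ioi_same (a := (0 : ℝ)) (b := L)) measurableSet_Ioi
    (hexp.mono_set Ioc_subset_Ioi_self) (hexp.mono_set (Ioi_subset_Ioi hL.le))
  rw [Ioc_union_Ioi_eq_Ioi hL.le] at hsplit
  have hEuler := mul_complexMGF_logMulExp_Ioi hw
  rw [complexMGF, hsplit] at hEuler
  rw [mul_integral_cexp_div_eq_sub_mul_integral_cexp hw hL, complexMGF]
  linear_combination -hEuler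

theorem cexp_add_mul_complexMGF_isBigO {L : ℝ} (hL : 0 ≤ L) :
    (fun w => Complex.exp (-w * logMulExp L) +
        w * complexMGF logMulExp (volume.restrict (Ioc 0 L)) (-w) - 1 + w * Real.log L)
      =O[𝓝 0] fun w => w ^ 2 := by
  have han : AnalyticAt ℂ (complexMGF logMulExp (volume.restrict (Ioc 0 L))) (-0) :=
    analyticAt_complexMGF (mem_interior_integrableExpSet_logMulExp_Ioc (by simp) L)
  have hK : AnalyticAt ℂ (fun w => complexMGF logMulExp (volume.restrict (Ioc 0 L)) (-w)) 0 :=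
    han.comp analyticAt_id.neg
  have hK0 : complexMGF logMulExp (volume.restrict (Ioc 0 L)) 0 = L := by
    simp [complexMGF, hL]
  have hE : HasDerivAt (fun w : ℂ => Complex.exp (-w * logMulExp L)) (-logMulExp L) 0 := by
    simpa using ((hasDerivAt_neg (0 : ℂ)).mul_const (logMulExp L : ℂ)).cexp
  have hderiv : HasDerivAt (fun w : ℂ => Complex.exp (-w * logMulExp L) +
      w * complexMGF logMulExp (volume.restrict (Ioc 0 L)) (-w)) (-Real.log L) 0 := by
    refine (hE.add ((hasDerivAt_id (0 : ℂ)).mul hK.differentiableAt.hasDerivAt)).congr_deriv ?_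
    simp [hK0, logMulExp]
  have hA : AnalyticAt ℂ (fun w : ℂ => Complex.exp (-w * logMulExp L) +
      w * complexMGF logMulExp (volume.restrict (Ioc 0 L)) (-w)) 0 :=
    (analyticAt_id.neg.mul analyticAt_const).cexp.add (analyticAt_id.mul hK)
  refine (isBigO_sub_sub_deriv_smul hA).congr_left fun w => ?_
  rw [hderiv.deriv]
  simp [hK0]

theorem integral_cexp_neg_mul_logMulExp_div_isBigO {L : ℝ} (hL : 0 < L) :
    (fun w => (∫ t in Ioi L, Complex.exp (-w * logMulExp t) / t) + Real.log L +
        (Complex.log w + Real.eulerMascheroniConstant))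
      =O[𝓝[{w : ℂ | 0 < w.re}] 0] fun w => w * Complex.log w ^ 2 := by
  have hlt : ∀ᶠ w : ℂ in 𝓝[{w : ℂ | 0 < w.re}] 0, w.re < 1 :=
    nhdsWithin_le_nhds (Complex.continuous_re.continuousAt.eventually_lt_const (by simp))
  have hanalytic := ((cexp_add_mul_complexMGF_isBigO hL.le).mono nhdsWithin_le_nhds).trans
    (isBigO_mul_log_sq _)
  have hmain := (hanalytic.sub cpow_self_mul_Gamma_isBigO).mono nhdsWithin_re_pos_le_nhdsNE
  refine ((isBigO_refl (fun w : ℂ => w⁻¹) _).mul hmain).congr' ?_ ?_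
  · filter_upwards [self_mem_nhdsWithin, hlt] with w hw hw1
    have hJ := mul_integral_cexp_div_eq_sub_cpow_mul_Gamma ⟨hw, hw1⟩ hL
    rw [inv_mul_eq_iff_eq_mul₀ (Complex.ne_zero_of_re_pos hw)]
    linear_combination -hJ
  · filter_upwards [self_mem_nhdsWithin] with w hw
    have := Complex.ne_zero_of_re_pos hw
    field_simp

theorem nLogNZeta_one_add_isBigO {C : ℝ} (hC : IsLogLogConstant C) :
    (fun w => nLogNZeta (1 + w) - (-Complex.log w + C - Real.eulerMascheroniConstant))
      =O[𝓝[{w : ℂ | 0 < w.re}] 0] fun w => w * Complex.log w ^ 2 := by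
  have hcomp := ((nLogNZeta_one_add_sub_integral_isBigO hC).mono inf_le_right).trans
    ((isBigO_mul_log_sq _).mono nhdsWithin_re_pos_le_nhdsNE)
  refine (hcomp.add (integral_cexp_neg_mul_logMulExp_div_isBigO
    (Real.log_pos one_lt_two))).congr_left fun w => ?_
  ring

theorem mainTheorem8 :
    (∀ s : ℂ, 1 < s.re →
      Summable (fun n : ℕ =>
        ((((n + 2 : ℕ) : ℝ) * Real.log ((n + 2 : ℕ) : ℝ) : ℝ) : ℂ) ^ (-s))) ∧
    ∃ C : ℝ, IsLogLogConstant C ∧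
      (fun s : ℂ => nLogNZeta s -
          (-Complex.log (s - 1) + (C : ℂ) - (Real.eulerMascheroniConstant : ℂ)))
        =O[𝓝[{s : ℂ | 1 < s.re}] 1]
      (fun s : ℂ => (s - 1) * Complex.log (s - 1) ^ 2) := by
  obtain ⟨C, hC⟩ := exists_isLogLogConstant
  refine ⟨fun s hs => summable_mul_log_cpow_neg hs, C, hC, ?_⟩
  have hshift : Tendsto (fun s : ℂ => s - 1) (𝓝[{s : ℂ | 1 < s.re}] 1)
      (𝓝[{w : ℂ | 0 < w.re}] 0) :=
    ((continuous_sub_right (1 : ℂ)).tendsto' 1 0 (sub_self 1)).inf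
      (tendsto_principal_principal.mpr fun s hs => by simpa using hs)
  simpa [Function.comp_def] using (nLogNZeta_one_add_isBigO hC).comp_tendsto hshift
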